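/- Let $1\le p<\infty$. There are constants $C_p,c_p,c>0$ depending only on $p$ such that the following holds. Let $(\Omega,\mu)$ be a probability space, let $L_\infty(\Omega)$ be the space of bounded measurable functions $f:\Omega\to\mathbb C$ with $\|f\|_\infty=\sup_{x\in\Omega}|f(x)|$, and write $\|f\|_p=(\int_\Omega|f|^p\,d\mu)^{1/p}$. Let $\mathcal W\subset L_\infty(\Omega)$ satisfy $\lambda\mathcal W=\mathcal W$ for every $\lambda>0$, put $\mathcal W_p=\{f\in\mathcal W:\|f\|_p\le1\}$, assume that $\mathcal W_p$ is a compact subset of $L_\infty(\Omega)$, and let $R=\sup_{f\in\mathcal W_p}\|f\|_\infty$. For $t>0$ let $N_t(\mathcal W_p,L_\infty)$ be the least number $n$ such that there are $g_1,\dots,g_n\in\mathcal W_p$ with $\max_{f\in\mathcal W_p}\min_j\|f-g_j\|_\infty\le t$, and let $\mathcal H_t(\mathcal W_p,L_\infty)=\log_2N_t(\mathcal W_p,L_\infty)$. Let $\xi^1,\dots,\xi^m$ be independent random points of $\Omega$ whose distributions $\mu_{\xi^k}$ satisfy $\frac1m\sum_{k=1}^m\mu_{\xi^k}=\mu$. If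 $0<\varepsilon<1$ and $$m\ge C_p\,\varepsilon^{-5}\left(\int_{c_p\varepsilon^{1/p}}^{R}u^{\frac p2-1}\Bigl(\int_u^R\frac{\mathcal H_{c_p\varepsilon t}(\mathcal W_p,L_\infty)}{t}\,dt\Bigr)^{1/2}du\right)^2,$$ then the inequalities $$(1-\varepsilon)\|f\|_p^p\le\frac1m\sum_{j=1}^m|f(\xi^j)|^p\le(1+\varepsilon)\|f\|_p^p\qquad\text{for all }f\in\mathcal W_p$$ hold with probability at least $$1-\varepsilon\exp\Bigl(-\frac{c\,m\,\varepsilon^4}{R^p\,(\log(2R/\varepsilon))^2}\Bigr).$$ (If $R=0$, so that $\mathcal W_p\subset\{0\}$, the fraction in the exponent is read as $0$.) -/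

import Mathlib

open scoped ENNReal Pointwise
open MeasureTheory ProbabilityTheory

/-- The space `L_∞(Ω)` of all bounded measurable functions `f : Ω → ℂ` (genuine functions, not
classes modulo null sets), as a subspace of Mathlib's space of all bounded functions on `Ω`.
The inherited norm is the supremum norm `‖f‖_∞ = sup_{x ∈ Ω} |f x|`. -/
def Linf (Ω : Type*) [MeasurableSpace Ω] : Submodule ℂ (lp (fun _ : Ω => ℂ) ∞) where
  carrier := {f | Measurable fun x => f x}
  add_mem' := by
    intro f g hf hg
    exact Measurable.add hf hg
  zero_mem' := by
    exact (measurable_const : Measurable fun _ : Ω => (0 : ℂ))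
  smul_mem' := by
    intro c f hf
    exact Measurable.const_mul hf c

instance (Ω : Type*) [MeasurableSpace Ω] : CoeFun (Linf Ω) (fun _ => Ω → ℂ) :=
  ⟨fun f => (f.1 : ∀ _ : Ω, ℂ)⟩

/-- `‖f‖_p ^ p = ∫ |f|^p dμ` for bounded measurable `f`. -/
noncomputable def normPow {Ω : Type*} [MeasurableSpace Ω] (μ : Measure Ω) (p : ℝ)
    (f : Linf Ω) : ℝ :=
  ∫ x, ‖f x‖ ^ p ∂μ

/-- `W_p = {f ∈ W : ‖f‖_p ≤ 1}`, with `‖f‖_p = (∫ |f|^p dμ)^(1/p)`. -/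
def unitBallIn {Ω : Type*} [MeasurableSpace Ω] (μ : Measure Ω) (p : ℝ)
    (W : Set (Linf Ω)) : Set (Linf Ω) :=
  {f ∈ W | normPow μ p f ^ (1 / p) ≤ 1}

/-- `sup_{f ∈ A} sup_{x ∈ Ω} |f x|`; for `A` compact this is a supremum of a bounded family
(equal to `0` when `A` is empty). -/
noncomputable def supBound {Ω : Type*} [MeasurableSpace Ω] (A : Set (Linf Ω)) : ℝ :=
  ⨆ f : A, ⨆ x : Ω, ‖f.1 x‖

/-- The `t`-entropy `H_t(A, X) = log₂ N_t(A, X)`, where `N_t(A, X)` is the least number of closed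
balls of radius `t` with centres in `A` that cover `A` (finite for `A` compact and `t > 0`). -/
noncomputable def entropy {X : Type*} [PseudoEMetricSpace X] (t : ℝ) (A : Set X) : ℝ :=
  Real.logb 2 ((Metric.coveringNumber t.toNNReal A).toNat : ℝ)

/-- The double integral
`∫_{c ε^{1/p}}^R u^{p/2-1} (∫_u^R H_{c ε t}(A, X) dt/t)^{1/2} du`. -/
noncomputable def entropyIntegral {X : Type*} [PseudoEMetricSpace X] (p c ε R : ℝ)
    (A : Set X) : ℝ :=
  ∫ u in (c * ε ^ (1 / p))..R,
    u ^ (p / 2 - 1) * Real.sqrt (∫ t in u..R, entropy (c * ε * t) A / t)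

/-!
By homogeneity it suffices to treat `f ∈ W_p` with `‖f‖_p = 1`. Put `θ = ε / (20 p)` and fix the
levels `u_k = R e^{-θ k}`, `k ≤ K`, down to about `ε^{1/p}`. For each `k` take a minimal net of `W_p`
of radius `c_p ε u_k`, and let `g_k` be a point of it close to `f`. The layer `D_k` consists of the
points where `|g_k| ≥ u_k` while `|g_l| < u_l` for all `l < k`. On `D_k` the function `|f|` equals `u_k` up
to a factor `e^{± 2 θ}`, and off all layers it is negligible (`layerSum_bounds`). So it is enough that
`u_k ^ p μ(D_k)` is reproduced by the sample up to an error `δ_k`, with `∑ δ_k ≤ ε / 10`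
(`discretization_of_layers`).

The layer `D_k` depends only on `g_0, …, g_k`, so there are at most `N_k = ∏_{l ≤ k} n_l` of them, with
`n_l` the sizes of the nets, and `log N_k` is at most `θ⁻¹ ∫_{u_{k+1}}^R H(t) dt / t`, where
`H(t) = H_{c_p ε t}(W_p, L_∞)`. As `u_k ^ p μ(D_k) ≤ 2`, a Chernoff bound
(`prob_frequency_deviation_le`) bounds the probability of a deviation `δ_k` for one layer by
`2 exp (-m δ_k² / (8 u_k ^ p))`. The choice
`δ_k = ε / (20 (K + 1)) + 4 (u_k ^ p θ⁻¹ ∫_{u_{k+1}}^R H(t) dt / (t m))^{1/2}` makes the exponent exceed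
`X + 2 log N_k`, where `X` is the exponent of the theorem, coming from `K + 1 ≲ ε⁻¹ log (2 R / ε)`.
The second summands of the `δ_k` add up to a Riemann sum of the entropy integral
(`sum_sqrt_level_le_integral`), which the hypothesis on `m` makes at most `ε / 20`; three of the five
powers of `ε` in that hypothesis come from `θ`.

A union bound leaves the failure probability `∑_k 2 e^{-X} / N_k`
(`exists_event_layer_deviation_le`). The factor `ε` in front of the exponential comes from the
invariance of `W` under dilations: `W_p` contains a segment from `0` to a function of norm at least
`R / 2`, so that every net has at least `16 / ε` points (`norm_le_card_mul_of_net`).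
-/

/-! ### Empirical frequencies of a set -/

lemma one_le_of_average_eq {Ω S : Type*} [MeasurableSpace Ω] [MeasurableSpace S]
    {μ : Measure Ω} [IsProbabilityMeasure μ] {P : Measure S} {m : ℕ} {ξ : Fin m → S → Ω}
    (hμ : (m : ℝ≥0∞)⁻¹ • ∑ j, P.map (ξ j) = μ) : 0 < m := by
  rcases Nat.eq_zero_or_pos m with rfl | h
  · simp at hμ
    exact absurd hμ.symm (IsProbabilityMeasure.ne_zero μ)
  · exact h

lemma sum_measureReal_preimage {Ω S : Type*} [MeasurableSpace Ω] [MeasurableSpace S]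
    {μ : Measure Ω} [IsProbabilityMeasure μ] {P : Measure S} [IsProbabilityMeasure P]
    {m : ℕ} {ξ : Fin m → S → Ω} (hξ : ∀ j, Measurable (ξ j))
    (hμ : (m : ℝ≥0∞)⁻¹ • ∑ j, P.map (ξ j) = μ) {A : Set Ω} (hA : MeasurableSet A) :
    ∑ j, P.real (ξ j ⁻¹' A) = m * μ.real A := by
  have hm : (0 : ℝ) < m := by exact_mod_cast one_le_of_average_eq hμ
  have h : μ A = (m : ℝ≥0∞)⁻¹ * ∑ j, P (ξ j ⁻¹' A) := by
    rw [← hμ]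
    simp [Measure.map_apply (hξ _) hA]
  rw [Measure.real, h, ENNReal.toReal_mul, ENNReal.toReal_sum (fun j _ => measure_ne_top _ _)]
  simp [Measure.real]
  field_simp

/-- The moment generating function of the number of sample points falling in `A`. -/
lemma mgf_count_le {Ω S : Type*} [MeasurableSpace Ω] [MeasurableSpace S]
    {μ : Measure Ω} [IsProbabilityMeasure μ] {P : Measure S} [IsProbabilityMeasure P]
    {m : ℕ} {ξ : Fin m → S → Ω} (hξ : ∀ j, Measurable (ξ j)) (hind : iIndepFun ξ P)
    (hμ : (m : ℝ≥0∞)⁻¹ • ∑ j, P.map (ξ j) = μ) {A : Set Ω} (hA : MeasurableSet A)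
    {t : ℝ} (ht : |t| ≤ 1) :
    mgf (∑ j, fun s => A.indicator (1 : Ω → ℝ) (ξ j s)) P t
      ≤ Real.exp (m * μ.real A * (t + t ^ 2)) := by
  have hmeas : Measurable (A.indicator (1 : Ω → ℝ)) := measurable_one.indicator hA
  have hind' : iIndepFun (fun j s => A.indicator (1 : Ω → ℝ) (ξ j s)) P :=
    hind.comp (fun _ => A.indicator (1 : Ω → ℝ)) (fun _ => hmeas)
  rw [hind'.mgf_sum (fun j => hmeas.comp (hξ j)), ← sum_measureReal_preimage hξ hμ hA,
    Finset.sum_mul, Real.exp_sum]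
  refine Finset.prod_le_prod (fun j _ => mgf_nonneg) (fun j _ => ?_)
  have e : (fun s => Real.exp (t * A.indicator (1 : Ω → ℝ) (ξ j s)))
      = fun s => 1 + (ξ j ⁻¹' A).indicator (fun _ => Real.exp t - 1) s := by
    funext s
    by_cases hs : ξ j s ∈ A <;> simp [hs]
  have hq : 0 ≤ P.real (ξ j ⁻¹' A) := measureReal_nonneg
  rw [mgf, e, integral_add (integrable_const _)
    ((integrable_const _).indicator (hξ j hA)), integral_indicator_const _ (hξ j hA)]
  have h1 := (abs_le.mp (Real.abs_exp_sub_one_sub_id_le ht)).2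
  have h2 := Real.add_one_le_exp (P.real (ξ j ⁻¹' A) * (t + t ^ 2))
  simp only [integral_const, probReal_univ, smul_eq_mul]
  nlinarith

/-- A Chernoff bound for the empirical frequency of `A`. The points need not be identically
distributed: only the average of their distributions enters. -/
theorem prob_frequency_deviation_le {Ω S : Type*} [MeasurableSpace Ω] [MeasurableSpace S]
    {μ : Measure Ω} [IsProbabilityMeasure μ] {P : Measure S} [IsProbabilityMeasure P]
    {m : ℕ} {ξ : Fin m → S → Ω} (hξ : ∀ j, Measurable (ξ j)) (hind : iIndepFun ξ P)
    (hμ : (m : ℝ≥0∞)⁻¹ • ∑ j, P.map (ξ j) = μ) {A : Set Ω} (hA : MeasurableSet A)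
    {b d : ℝ} (hd : 0 < d) (hdb : d ≤ 2 * b) (hab : μ.real A ≤ b) :
    P.real {s | d ≤ |1 / (m : ℝ) * ∑ j, A.indicator (1 : Ω → ℝ) (ξ j s) - μ.real A|}
      ≤ 2 * Real.exp (-(m * d ^ 2 / (4 * b))) := by
  have hm : (0 : ℝ) < m := by exact_mod_cast one_le_of_average_eq hμ
  have hb : 0 < b := by linarith
  set X : S → ℝ := ∑ j, fun s => A.indicator (1 : Ω → ℝ) (ξ j s) with hX
  set a := μ.real A
  have hmeasX : Measurable X := by
    have : ∀ j, Measurable fun s => A.indicator (1 : Ω → ℝ) (ξ j s) := fun j =>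
      (measurable_one.indicator hA).comp (hξ j)
    rw [hX]
    fun_prop
  have hXnonneg : ∀ s, 0 ≤ X s := fun s => by
    simp only [hX, Finset.sum_apply]
    exact Finset.sum_nonneg fun j _ => Set.indicator_nonneg (fun _ _ => zero_le_one) _
  have hXle : ∀ s, X s ≤ m := fun s => by
    simp only [hX, Finset.sum_apply]
    calc _ ≤ ∑ _j : Fin m, (1 : ℝ) := Finset.sum_le_sum fun j _ =>
          Set.indicator_le' (fun _ _ => le_rfl) (fun _ _ => zero_le_one) _
      _ = m := by simp
  have hint : ∀ t : ℝ, Integrable (fun s => Real.exp (t * X s)) P := fun t => by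
    refine Integrable.of_bound (by fun_prop) (Real.exp (|t| * m)) (ae_of_all _ fun s => ?_)
    rw [Real.norm_eq_abs, Real.abs_exp, Real.exp_le_exp]
    calc t * X s ≤ |t| * X s := mul_le_mul_of_nonneg_right (le_abs_self t) (hXnonneg s)
      _ ≤ |t| * m := mul_le_mul_of_nonneg_left (hXle s) (abs_nonneg t)
  -- the exponent `m (b λ² - λ d)` is minimal at this `λ`
  set l := d / (2 * b) with hl
  have hl0 : 0 < l := by positivity
  have hl1 : l ≤ 1 := by rw [hl, div_le_one (by positivity)]; exact hdb
  have hexp : m * (b * l ^ 2 - l * d) = -(m * d ^ 2 / (4 * b)) := by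
    rw [hl]; field_simp; ring
  have hal : a * l ^ 2 ≤ b * l ^ 2 := mul_le_mul_of_nonneg_right hab (sq_nonneg l)
  have up : P.real {s | m * (a + d) ≤ X s} ≤ Real.exp (-(m * d ^ 2 / (4 * b))) := by
    refine (measure_ge_le_exp_mul_mgf _ hl0.le (hint l)).trans ?_
    calc _ ≤ Real.exp (-l * (m * (a + d))) * Real.exp (m * a * (l + l ^ 2)) := by
          gcongr
          exact mgf_count_le hξ hind hμ hA (by rwa [abs_of_pos hl0])
      _ ≤ _ := by
          rw [← Real.exp_add, Real.exp_le_exp, ← hexp]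
          nlinarith
  have low : P.real {s | X s ≤ m * (a - d)} ≤ Real.exp (-(m * d ^ 2 / (4 * b))) := by
    refine (measure_le_le_exp_mul_mgf _ (neg_nonpos.mpr hl0.le) (hint (-l))).trans ?_
    calc _ ≤ Real.exp (- -l * (m * (a - d))) * Real.exp (m * a * (-l + (-l) ^ 2)) := by
          gcongr
          exact mgf_count_le hξ hind hμ hA (by rwa [abs_neg, abs_of_pos hl0])
      _ ≤ _ := by
          rw [← Real.exp_add, Real.exp_le_exp, ← hexp]
          nlinarith
  have hsub : {s | d ≤ |1 / (m : ℝ) * ∑ j, A.indicator (1 : Ω → ℝ) (ξ j s) - a|}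
      ⊆ {s | m * (a + d) ≤ X s} ∪ {s | X s ≤ m * (a - d)} := by
    intro s hs
    have hXs : X s = ∑ j, A.indicator (1 : Ω → ℝ) (ξ j s) := by simp [hX]
    simp only [Set.mem_ofPred_eq, ← hXs] at hs
    have e : X s = m * (1 / (m : ℝ) * X s) := by field_simp
    rcases le_abs.mp hs with h | h
    · left
      rw [Set.mem_ofPred_eq, e]
      exact mul_le_mul_of_nonneg_left (by linarith) hm.le
    · right
      rw [Set.mem_ofPred_eq, e]
      exact mul_le_mul_of_nonneg_left (by linarith) hm.le
  calc _ ≤ _ := measureReal_mono hsub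
    _ ≤ _ := measureReal_union_le _ _
    _ ≤ _ := by linarith

/-! ### Layers of a function -/

/-- The points where the `k`-th approximant reaches its level `u k` while every earlier one stays
below its own level. Only the approximants with index at most `k` enter, so that finitely many
choices of these give finitely many layers. -/
def layer {Ω : Type*} [MeasurableSpace Ω] (u : ℕ → ℝ) (k : ℕ) (g : Fin (k + 1) → Linf Ω) : Set Ω :=
  {x | u k ≤ ‖g (Fin.last k) x‖ ∧ ∀ l : Fin (k + 1), (l : ℕ) < k → ‖g l x‖ < u l}

lemma measurableSet_layer {Ω : Type*} [MeasurableSpace Ω] (u : ℕ → ℝ) (k : ℕ)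
    (g : Fin (k + 1) → Linf Ω) : MeasurableSet (layer u k g) := by
  have h : ∀ l, Measurable fun x => ‖g l x‖ := fun l => (g l).2.norm
  have e : layer u k g = {x | u k ≤ ‖g (Fin.last k) x‖} ∩
      ⋂ l : Fin (k + 1), ⋂ _ : (l : ℕ) < k, {x | ‖g l x‖ < u l} := by
    ext x; simp [layer]
  rw [e]
  exact (measurableSet_le measurable_const (h _)).inter <| MeasurableSet.iInter fun l =>
    MeasurableSet.iInter fun _ => measurableSet_lt (h l) measurable_const

/-- The step function that takes the value `u k ^ p` on the `k`-th layer. -/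
noncomputable def layerSum {Ω : Type*} [MeasurableSpace Ω] (p : ℝ) (u : ℕ → ℝ) (K : ℕ)
    (g : ℕ → Linf Ω) (x : Ω) : ℝ :=
  ∑ k ∈ Finset.range (K + 1), u k ^ p * (layer u k fun l => g l).indicator (1 : Ω → ℝ) x

lemma exp_neg_two_mul_le {θ : ℝ} (h0 : 0 ≤ θ) (h1 : θ ≤ 1 / 2) : Real.exp (-(2 * θ)) ≤ 1 - θ := by
  rw [Real.exp_neg, inv_le_comm₀ (Real.exp_pos _) (by linarith)]
  have := Real.add_one_le_exp (2 * θ)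
  rw [inv_le_iff_one_le_mul₀ (by linarith)]
  nlinarith

lemma layerSum_bounds {Ω : Type*} [MeasurableSpace Ω] {p θ : ℝ} {u : ℕ → ℝ} {K : ℕ}
    {f : Linf Ω} {g : ℕ → Linf Ω} {x : Ω} (hp : 0 ≤ p) (h0 : 0 ≤ θ) (h1 : θ ≤ 1 / 2)
    (hu : ∀ k, 0 < u k) (hr : ∀ k, u k ≤ Real.exp θ * u (k + 1)) (hf : ‖f x‖ ≤ u 0)
    (hg : ∀ k, |‖f x‖ - ‖g k x‖| ≤ θ * u k) :
    Real.exp (-(2 * θ * p)) * layerSum p u K g x ≤ ‖f x‖ ^ p ∧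
    ‖f x‖ ^ p ≤ Real.exp (2 * θ * p) * layerSum p u K g x + (2 * u K) ^ p := by
  classical
  have hF := norm_nonneg (f x)
  by_cases hex : ∃ k, u k ≤ ‖g k x‖ ∧ k ≤ K
  · have hspec := Nat.find_spec hex
    have hmin : ∀ l < Nat.find hex, ‖g l x‖ < u l := fun l hl => by
      have := Nat.find_min hex hl
      by_contra hcon
      exact this ⟨not_lt.mp hcon, hl.le.trans hspec.2⟩
    set k := Nat.find hex
    have hsum : layerSum p u K g x = u k ^ p := by
      unfold layerSum
      rw [Finset.sum_eq_single k]
      · rw [Set.indicator_of_mem]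
        · simp
        · exact ⟨hspec.1, fun l hl => hmin l hl⟩
      · intro l hl hne
        rw [Set.indicator_of_notMem, mul_zero]
        rintro ⟨h2, h3⟩
        rcases lt_or_gt_of_ne hne with h | h
        · exact absurd (hmin l h) (not_lt.mpr h2)
        · exact absurd (h3 ⟨k, by omega⟩ h) (not_lt.mpr hspec.1)
      · intro h
        exact absurd (Finset.mem_range.mpr (by omega)) h
    have hlow : Real.exp (-(2 * θ)) * u k ≤ ‖f x‖ := by
      have := (abs_le.mp (hg k)).1
      have := mul_le_mul_of_nonneg_right (exp_neg_two_mul_le h0 h1) (hu k).le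
      linarith [hspec.1]
    have hup : ‖f x‖ ≤ Real.exp (2 * θ) * u k := by
      rcases Nat.eq_zero_or_pos k with hk | hk
      · rw [hk]
        have : 1 ≤ Real.exp (2 * θ) := Real.one_le_exp (by linarith)
        nlinarith [hu 0]
      · obtain ⟨j, hj⟩ : ∃ j, k = j + 1 := ⟨k - 1, by omega⟩
        have h2 := hmin j (by omega)
        have h3 := (abs_le.mp (hg j)).2
        have h4 : (1 + θ) * u j ≤ Real.exp θ * (Real.exp θ * u (j + 1)) :=
          mul_le_mul (by linarith [Real.add_one_le_exp θ]) (hr j) (hu j).le (Real.exp_pos _).le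
        rw [hj, two_mul, Real.exp_add]
        linarith
    rw [hsum]
    constructor
    · calc _ = (Real.exp (-(2 * θ)) * u k) ^ p := by
            rw [Real.mul_rpow (Real.exp_pos _).le (hu k).le, ← Real.exp_mul]; ring_nf
        _ ≤ _ := Real.rpow_le_rpow (mul_nonneg (Real.exp_pos _).le (hu k).le) hlow hp
    · calc _ ≤ (Real.exp (2 * θ) * u k) ^ p := Real.rpow_le_rpow hF hup hp
        _ = Real.exp (2 * θ * p) * u k ^ p := by
            rw [Real.mul_rpow (Real.exp_pos _).le (hu k).le, ← Real.exp_mul]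
        _ ≤ _ := le_add_of_nonneg_right (Real.rpow_nonneg (by linarith [hu K]) _)
  · push Not at hex
    have hsum : layerSum p u K g x = 0 := by
      refine Finset.sum_eq_zero fun k hk => ?_
      rw [Set.indicator_of_notMem, mul_zero]
      rintro ⟨h2, -⟩
      have := hex k h2
      rw [Finset.mem_range] at hk
      omega
    rw [hsum]
    refine ⟨by simpa using Real.rpow_nonneg hF p, ?_⟩
    rw [mul_zero, zero_add]
    refine Real.rpow_le_rpow hF ?_ hp
    have h2 : ‖g K x‖ < u K := by
      by_contra hcon
      exact absurd (hex K (not_lt.mp hcon)) (lt_irrefl _)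
    have := (abs_le.mp (hg K)).2
    nlinarith [hu K]

lemma integrable_norm_rpow {Ω : Type*} [MeasurableSpace Ω] (μ : Measure Ω) [IsFiniteMeasure μ]
    {p : ℝ} (hp : 0 ≤ p) (f : Linf Ω) : Integrable (fun x => ‖f x‖ ^ p) μ := by
  have hm : Measurable fun x => ‖f x‖ := f.2.norm
  refine Integrable.of_bound (hm.pow_const p).aestronglyMeasurable
    (‖f‖ ^ p) (ae_of_all _ fun x => ?_)
  rw [Real.norm_of_nonneg (Real.rpow_nonneg (norm_nonneg _) _)]
  exact Real.rpow_le_rpow (norm_nonneg _) (lp.norm_apply_le_norm (by simp) f.1 x) hp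

lemma integral_layerSum {Ω : Type*} [MeasurableSpace Ω] (μ : Measure Ω) [IsFiniteMeasure μ]
    (p : ℝ) (u : ℕ → ℝ) (K : ℕ) (g : ℕ → Linf Ω) :
    Integrable (layerSum p u K g) μ ∧ ∫ x, layerSum p u K g x ∂μ
      = ∑ k ∈ Finset.range (K + 1), u k ^ p * μ.real (layer u k fun l => g l) := by
  have hi : ∀ k, Integrable
      (fun x => u k ^ p * (layer u k fun l => g l).indicator (1 : Ω → ℝ) x) μ := fun k =>
    ((integrable_const (1 : ℝ)).indicator (measurableSet_layer u k _)).const_mul _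
  refine ⟨integrable_finsetSum _ fun k _ => hi k, ?_⟩
  unfold layerSum
  rw [integral_finsetSum _ fun k _ => hi k]
  refine Finset.sum_congr rfl fun k _ => ?_
  rw [integral_const_mul, integral_indicator_one (measurableSet_layer u k _)]

/-- On a function of norm one, discretization of `‖f‖_p ^ p` follows from discretization of
the measures of its layers. -/
theorem discretization_of_layers {Ω : Type*} [MeasurableSpace Ω] {μ : Measure Ω}
    [IsProbabilityMeasure μ] {p θ ε : ℝ} {u δ : ℕ → ℝ} {K m : ℕ} {f : Linf Ω} {g : ℕ → Linf Ω}
    {y : Fin m → Ω} (hm : 0 < m) (hp : 0 ≤ p) (h0 : 0 ≤ θ) (h1 : θ ≤ 1 / 2)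
    (hu : ∀ k, 0 < u k) (hr : ∀ k, u k ≤ Real.exp θ * u (k + 1)) (hf : ∀ x, ‖f x‖ ≤ u 0)
    (hg : ∀ k x, |‖f x‖ - ‖g k x‖| ≤ θ * u k) (hnorm : normPow μ p f = 1)
    (hε0 : 0 < ε) (hε1 : ε < 1) (hθ : 2 * θ * p = ε / 10) (hK : (2 * u K) ^ p ≤ ε / 10)
    (hδ : ∑ k ∈ Finset.range (K + 1), δ k ≤ ε / 10)
    (hdev : ∀ k ≤ K, u k ^ p * |1 / (m : ℝ) * ∑ j,
      (layer u k fun l => g l).indicator (1 : Ω → ℝ) (y j)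
        - μ.real (layer u k fun l => g l)| ≤ δ k) :
    1 - ε ≤ 1 / (m : ℝ) * ∑ j, ‖f (y j)‖ ^ p ∧ 1 / (m : ℝ) * ∑ j, ‖f (y j)‖ ^ p ≤ 1 + ε := by
  have hm' : (0 : ℝ) < m := by exact_mod_cast hm
  have hb := fun x => layerSum_bounds (K := K) hp h0 h1 hu hr (hf x) (fun k => hg k x)
  obtain ⟨hint, hval⟩ := integral_layerSum μ p u K g
  set I := ∫ x, layerSum p u K g x ∂μ with hI
  set M := 1 / (m : ℝ) * ∑ j, layerSum p u K g (y j) with hM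
  rw [hθ] at hb
  have hfi := integrable_norm_rpow μ hp f
  have hIup : Real.exp (-(ε / 10)) * I ≤ 1 := by
    rw [← hnorm, hI, normPow, ← integral_const_mul]
    exact integral_mono (hint.const_mul _) hfi fun x => (hb x).1
  have hIlow : 1 ≤ Real.exp (ε / 10) * I + ε / 10 := by
    rw [← hnorm, hI, normPow, ← integral_const_mul]
    calc _ ≤ ∫ x, (Real.exp (ε / 10) * layerSum p u K g x + (2 * u K) ^ p) ∂μ :=
          integral_mono hfi ((hint.const_mul _).add (integrable_const _)) fun x => (hb x).2
      _ = ∫ x, Real.exp (ε / 10) * layerSum p u K g x ∂μ + (2 * u K) ^ p := by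
          rw [integral_add (hint.const_mul _) (integrable_const _), integral_const,
            probReal_univ, one_smul]
      _ ≤ _ := by linarith
  have hdiff : |M - I| ≤ ε / 10 := by
    have hMe : M = ∑ k ∈ Finset.range (K + 1), u k ^ p * (1 / (m : ℝ) * ∑ j,
        (layer u k fun l => g l).indicator (1 : Ω → ℝ) (y j)) := by
      rw [hM]
      unfold layerSum
      rw [Finset.sum_comm, Finset.mul_sum]
      refine Finset.sum_congr rfl fun k _ => ?_
      rw [← Finset.mul_sum]; ring
    rw [hMe, hval, ← Finset.sum_sub_distrib]
    refine (Finset.abs_sum_le_sum_abs _ _).trans (le_trans (Finset.sum_le_sum fun k hk => ?_) hδ)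
    rw [← mul_sub, abs_mul, abs_of_nonneg (Real.rpow_nonneg (hu k).le p)]
    exact hdev k (by rw [Finset.mem_range] at hk; omega)
  have hMlow : Real.exp (-(ε / 10)) * M ≤ 1 / (m : ℝ) * ∑ j, ‖f (y j)‖ ^ p := by
    rw [hM, mul_left_comm, Finset.mul_sum]
    gcongr with j
    exact (hb (y j)).1
  have hMup : 1 / (m : ℝ) * ∑ j, ‖f (y j)‖ ^ p ≤ Real.exp (ε / 10) * M + ε / 10 := by
    calc 1 / (m : ℝ) * ∑ j, ‖f (y j)‖ ^ p
        ≤ 1 / (m : ℝ) * ∑ j, (Real.exp (ε / 10) * layerSum p u K g (y j) + (2 * u K) ^ p) := by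
          gcongr with j
          exact (hb (y j)).2
      _ = Real.exp (ε / 10) * M + (2 * u K) ^ p := by
          rw [Finset.sum_add_distrib, ← Finset.mul_sum, hM]
          simp only [Finset.sum_const, Finset.card_univ, Fintype.card_fin, nsmul_eq_mul]
          field_simp
      _ ≤ _ := by linarith
  obtain ⟨hd1, hd2⟩ := abs_le.mp hdiff
  have he1 : 1 - ε / 10 ≤ Real.exp (-(ε / 10)) := by
    linarith [Real.add_one_le_exp (-(ε / 10))]
  have he2 : Real.exp (ε / 10) ≤ 1 + ε / 10 + (ε / 10) ^ 2 := by
    have := (abs_le.mp (Real.abs_exp_sub_one_sub_id_le (x := ε / 10)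
      (by rw [abs_of_pos] <;> linarith))).2
    linarith
  have hinv : Real.exp (-(ε / 10)) * Real.exp (ε / 10) = 1 := by rw [← Real.exp_add]; simp
  set a := Real.exp (-(ε / 10))
  set b := Real.exp (ε / 10)
  have ha0 : 0 < a := Real.exp_pos _
  have hb0 : 0 < b := Real.exp_pos _
  have ha1 : a ≤ 1 := Real.exp_le_one_iff.mpr (by linarith)
  -- `a (1 - ε / 10) ≤ I ≤ b`
  have hI1 : a * (1 - ε / 10) ≤ I := by
    have : a * (1 - ε / 10) ≤ a * (b * I) := mul_le_mul_of_nonneg_left (by linarith) ha0.le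
    rwa [← mul_assoc, hinv, one_mul] at this
  have hI2 : I ≤ b := by
    have : b * (a * I) ≤ b * 1 := mul_le_mul_of_nonneg_left hIup hb0.le
    rwa [← mul_assoc, mul_comm b a, hinv, one_mul, mul_one] at this
  constructor
  · refine le_trans ?_ hMlow
    have h2 : (1 - ε / 10) * (1 - ε / 10) ≤ a * (1 - ε / 10) :=
      mul_le_mul_of_nonneg_right he1 (by linarith)
    have h3 : (1 - ε / 10) * (1 - ε / 10) - ε / 10 ≤ M := by linarith
    have h4 : 0 ≤ (1 - ε / 10) * (1 - ε / 10) - ε / 10 := by nlinarith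
    calc 1 - ε ≤ (1 - ε / 10) * ((1 - ε / 10) * (1 - ε / 10) - ε / 10) := by nlinarith
      _ ≤ a * M := mul_le_mul he1 h3 h4 ha0.le
  · refine hMup.trans ?_
    have h2 : b ≤ 1 + ε / 5 := by nlinarith
    have h3 : b * M ≤ (1 + ε / 5) * (1 + ε / 5 + ε / 10) :=
      mul_le_mul_of_nonneg h2 (by linarith) hb0.le (by linarith)
    nlinarith

lemma layer_measure_le {Ω : Type*} [MeasurableSpace Ω] {μ : Measure Ω}
    [IsProbabilityMeasure μ] {p θ : ℝ} {u : ℕ → ℝ} {f : Linf Ω} {g : ℕ → Linf Ω}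
    (hp : 0 ≤ p) (h0 : 0 ≤ θ) (h1 : θ ≤ 1 / 2)
    (hu : ∀ k, 0 < u k) (hr : ∀ k, u k ≤ Real.exp θ * u (k + 1)) (hf : ∀ x, ‖f x‖ ≤ u 0)
    (hg : ∀ k x, |‖f x‖ - ‖g k x‖| ≤ θ * u k) (hnorm : normPow μ p f = 1)
    (hθ : 2 * θ * p ≤ 1 / 10) (k : ℕ) : u k ^ p * μ.real (layer u k fun l => g l) ≤ 2 := by
  obtain ⟨hint, hval⟩ := integral_layerSum μ p u k g
  have hI : Real.exp (-(2 * θ * p)) * ∫ x, layerSum p u k g x ∂μ ≤ 1 := by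
    rw [← hnorm, normPow, ← integral_const_mul]
    exact integral_mono (hint.const_mul _) (integrable_norm_rpow μ hp f) fun x =>
      (layerSum_bounds hp h0 h1 hu hr (hf x) (fun k => hg k x)).1
  have hle : u k ^ p * μ.real (layer u k fun l => g l) ≤ ∫ x, layerSum p u k g x ∂μ := by
    rw [hval]
    exact Finset.single_le_sum (f := fun k => u k ^ p * μ.real (layer u k fun l => g l))
      (fun i _ => mul_nonneg (Real.rpow_nonneg (hu i).le p) measureReal_nonneg)
      (Finset.self_mem_range_succ k)
  have he : 1 - 1 / 10 ≤ Real.exp (-(2 * θ * p)) := by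
    linarith [Real.add_one_le_exp (-(2 * θ * p))]
  have hn : 0 ≤ u k ^ p * μ.real (layer u k fun l => g l) :=
    mul_nonneg (Real.rpow_nonneg (hu k).le p) measureReal_nonneg
  nlinarith

/-! ### Nets and entropy -/

lemma coveringNumber_ne_top {X : Type*} [PseudoMetricSpace X] {A : Set X} (hA : IsCompact A)
    {t : ℝ} (ht : 0 < t) : Metric.coveringNumber t.toNNReal A ≠ ⊤ := by
  obtain ⟨C, hCA, hCf, hC⟩ := Metric.finite_approx_of_totallyBounded hA.totallyBounded t ht
  have hcov : Metric.IsCover t.toNNReal A C := by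
    intro x hx
    obtain ⟨y, hy, hxy⟩ := Set.mem_iUnion₂.mp (hC hx)
    refine ⟨y, hy, ?_⟩
    change edist x y ≤ _
    rw [edist_dist]
    exact ENNReal.ofReal_le_ofReal (Metric.mem_ball.mp hxy).le
  exact ne_top_of_le_ne_top (Set.encard_ne_top_iff.mpr hCf)
    (hcov.coveringNumber_le_encard hCA)

/-- A cover of minimal cardinality, as a finite set. -/
lemma exists_minimal_net {X : Type*} [PseudoMetricSpace X] {A : Set X} (hA : IsCompact A)
    {t : ℝ} (ht : 0 < t) : ∃ C : Finset X,
      (∀ x ∈ A, ∃ y ∈ C, dist x y ≤ t) ∧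
      C.card = (Metric.coveringNumber t.toNNReal A).toNat := by
  have hne := coveringNumber_ne_top hA ht
  refine ⟨(Metric.finite_minimalCover (ε := t.toNNReal) (A := A)).toFinset, ?_, ?_⟩
  · intro x hx
    obtain ⟨y, hy, hxy⟩ := Metric.isCover_minimalCover hne hx
    refine ⟨y, by simpa using hy, ?_⟩
    change edist x y ≤ _ at hxy
    rw [edist_dist] at hxy
    exact (ENNReal.ofReal_le_ofReal_iff ht.le).mp hxy
  · rw [← Metric.encard_minimalCover hne, ← Set.ncard_eq_toFinset_card _ _]
    rfl

lemma entropy_nonneg {X : Type*} [PseudoEMetricSpace X] (t : ℝ) (A : Set X) :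
    0 ≤ entropy t A := by
  rw [entropy, Real.logb]
  exact div_nonneg (Real.log_natCast_nonneg _) (Real.log_nonneg one_le_two)

lemma entropy_anti {X : Type*} [PseudoMetricSpace X] {A : Set X} (hA : IsCompact A)
    (hne : A.Nonempty) {s t : ℝ} (hs : 0 < s) (hst : s ≤ t) : entropy t A ≤ entropy s A := by
  have h1 : 0 < (Metric.coveringNumber t.toNNReal A).toNat := by
    rw [Nat.pos_iff_ne_zero, Ne, ENat.toNat_eq_zero, not_or]
    exact ⟨(Metric.coveringNumber_pos_iff.mpr hne).ne', coveringNumber_ne_top hA (hs.trans_le hst)⟩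
  rw [entropy, entropy]
  refine Real.logb_le_logb_of_le one_lt_two (by exact_mod_cast h1) ?_
  exact_mod_cast ENat.toNat_le_toNat (Metric.coveringNumber_anti (Real.toNNReal_le_toNNReal hst))
    (coveringNumber_ne_top hA hs)

/-- The norms of the points of a net for a set that contains a segment from the origin are
`t`-dense in an interval, so the net has many points. -/
lemma norm_le_card_mul_of_net {E : Type*} [NormedAddCommGroup E] [NormedSpace ℝ E] {A : Set E}
    {f : E} (hf : ∀ a : ℝ, 0 < a → a ≤ 1 → a • f ∈ A) {t : ℝ} {C : Finset E}
    (hC : ∀ x ∈ A, ∃ y ∈ C, dist x y ≤ t) : ‖f‖ ≤ C.card * (2 * t) := by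
  rcases eq_or_ne f 0 with rfl | h0
  · obtain ⟨y, -, hy⟩ := hC _ (hf 1 one_pos le_rfl)
    rw [norm_zero]
    have := dist_nonneg.trans hy
    positivity
  have hn : 0 < ‖f‖ := norm_pos_iff.mpr h0
  obtain ⟨y, -, hy⟩ := hC _ (hf 1 one_pos le_rfl)
  have ht : 0 ≤ t := dist_nonneg.trans hy
  have hsub : Set.Ioc 0 ‖f‖ ⊆ ⋃ y ∈ C, Set.Icc (‖y‖ - t) (‖y‖ + t) := by
    intro a ha
    have hmem := hf (a / ‖f‖) (div_pos ha.1 hn) ((div_le_one hn).mpr ha.2)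
    obtain ⟨y, hy, hd⟩ := hC _ hmem
    have hna : ‖(a / ‖f‖) • f‖ = a := by
      rw [norm_smul, Real.norm_of_nonneg (div_pos ha.1 hn).le, div_mul_cancel₀ _ hn.ne']
    have h2 := (abs_norm_sub_norm_le ((a / ‖f‖) • f) y).trans ((dist_eq_norm _ y).symm.le.trans hd)
    rw [hna] at h2
    have h3 := abs_le.mp h2
    exact Set.mem_biUnion hy ⟨by linarith, by linarith⟩
  have hvol := (measure_mono hsub).trans (measure_biUnion_finset_le (μ := volume) C _)
  simp only [Real.volume_Ioc, Real.volume_Icc, sub_zero] at hvol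
  rw [← ENNReal.ofReal_sum_of_nonneg (fun y _ => by linarith)] at hvol
  have h4 := (ENNReal.ofReal_le_ofReal_iff
    (Finset.sum_nonneg fun y _ => by linarith)).mp hvol
  refine h4.trans (le_of_eq ?_)
  rw [← nsmul_eq_mul, ← Finset.sum_const]
  exact Finset.sum_congr rfl fun y _ => by ring

/-! ### Geometric levels and the entropy integral -/

/-- The decreasing geometric progression of levels, from `R` downwards. -/
noncomputable def level (R θ : ℝ) (k : ℕ) : ℝ := R * Real.exp (-(θ * k))

lemma level_pos {R θ : ℝ} (hR : 0 < R) (k : ℕ) : 0 < level R θ k :=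
  mul_pos hR (Real.exp_pos _)

lemma level_zero (R θ : ℝ) : level R θ 0 = R := by simp [level]

lemma level_eq_exp_mul_succ (R θ : ℝ) (k : ℕ) :
    level R θ k = Real.exp θ * level R θ (k + 1) := by
  rw [level, level, mul_left_comm, ← Real.exp_add]
  congr 2
  push_cast
  ring

lemma level_antitone {R θ : ℝ} (hR : 0 ≤ R) (hθ : 0 ≤ θ) : Antitone (level R θ) := by
  intro a b hab
  unfold level
  gcongr

lemma level_le {R θ : ℝ} (hR : 0 ≤ R) (hθ : 0 ≤ θ) (k : ℕ) : level R θ k ≤ R :=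
  (level_antitone hR hθ (Nat.zero_le k)).trans_eq (level_zero R θ)

/-- Consecutive levels enclose an interval of logarithmic length `θ`. -/
lemma mul_le_integral_level {R θ C : ℝ} (hR : 0 < R) (hθ : 0 ≤ θ) (k : ℕ) {F : ℝ → ℝ}
    (hF : IntervalIntegrable F volume (level R θ (k + 1)) (level R θ k))
    (hC : ∀ t ∈ Set.Icc (level R θ (k + 1)) (level R θ k), C * t⁻¹ ≤ F t) :
    C * θ ≤ ∫ t in level R θ (k + 1)..level R θ k, F t := by
  have ha := level_pos (θ := θ) hR (k + 1)
  have hb := level_pos (θ := θ) hR k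
  have hle := level_antitone hR.le hθ (Nat.le_succ k)
  have h : ∫ t in level R θ (k + 1)..level R θ k, C * t⁻¹ = C * θ := by
    rw [intervalIntegral.integral_const_mul, integral_inv_of_pos ha hb,
      level_eq_exp_mul_succ R θ k, mul_div_cancel_right₀ _ ha.ne', Real.log_exp]
  rw [← h]
  refine intervalIntegral.integral_mono_on hle ?_ hF hC
  refine ContinuousOn.intervalIntegrable ?_
  rw [Set.uIcc_of_le hle]
  exact continuousOn_const.mul (continuousOn_id.inv₀ fun t ht => (ha.trans_le ht.1).ne')

lemma intervalIntegrable_div_of_antitoneOn {H : ℝ → ℝ} (hH : AntitoneOn H (Set.Ioi 0))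
    {a b : ℝ} (ha : 0 < a) (hb : 0 < b) :
    IntervalIntegrable (fun t => H t / t) volume a b := by
  have hsub : Set.uIcc a b ⊆ Set.Ioi 0 := fun t ht => (lt_min ha hb).trans_le ht.1
  have h1 : IntervalIntegrable H volume a b := (hH.mono hsub).intervalIntegrable
  simp_rw [div_eq_mul_inv]
  exact h1.mul_continuousOn (continuousOn_id.inv₀ fun t ht => (hsub ht).ne')

lemma antitoneOn_integral_div {H : ℝ → ℝ} (hH : AntitoneOn H (Set.Ioi 0)) (h0 : ∀ t, 0 ≤ H t)
    {R : ℝ} (hR : 0 < R) :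
    AntitoneOn (fun v => ∫ t in v..R, H t / t) (Set.Ioc 0 R) := by
  intro a ha b hb hab
  refine intervalIntegral.integral_mono_interval hab hb.2 le_rfl ?_
    (intervalIntegrable_div_of_antitoneOn hH ha.1 hR)
  filter_upwards [ae_restrict_mem measurableSet_Ioc] with t ht
  exact div_nonneg (h0 t) (ha.1.trans ht.1).le

lemma sum_level_le_integral {H : ℝ → ℝ} (hH : AntitoneOn H (Set.Ioi 0))
    {R θ : ℝ} (hR : 0 < R) (hθ : 0 ≤ θ) (n : ℕ) :
    (∑ l ∈ Finset.range n, H (level R θ l)) * θ ≤ ∫ t in level R θ n..R, H t / t := by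
  induction n with
  | zero => simp [level_zero]
  | succ n ih =>
    have hi := fun a b => intervalIntegrable_div_of_antitoneOn hH
      (level_pos (θ := θ) hR a) (level_pos (θ := θ) hR b)
    have hi0 := hi n 0
    rw [level_zero] at hi0
    rw [Finset.sum_range_succ, add_mul,
      ← intervalIntegral.integral_add_adjacent_intervals (hi (n + 1) n) hi0, add_comm]
    refine add_le_add (mul_le_integral_level hR hθ n (hi _ _) fun t ht => ?_) ih
    have ht0 : 0 < t := (level_pos hR _).trans_le ht.1
    rw [div_eq_mul_inv]
    exact mul_le_mul_of_nonneg_right (hH ht0 (level_pos hR n) ht.2) (inv_nonneg.mpr ht0.le)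

/-- Comparison of a sum over levels with the entropy integral. -/
lemma sum_sqrt_level_le_integral {G : ℝ → ℝ} {R θ p : ℝ} (hR : 0 < R)
    (hG : AntitoneOn G (Set.Ioc 0 R)) (hG0 : ∀ t ∈ Set.Ioc 0 R, 0 ≤ G t)
    (hθ : 0 ≤ θ) (hp : 0 ≤ p) (n : ℕ) {a : ℝ} (ha : 0 < a) (han : a ≤ level R θ (n + 1)) :
    (∑ k ∈ Finset.range n, level R θ k ^ (p / 2) * G (level R θ (k + 1))) * θ
      ≤ Real.exp (θ * p) * ∫ u in a..R, u ^ (p / 2 - 1) * G u := by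
  have hi : ∀ a b, a ∈ Set.Ioc 0 R → b ∈ Set.Ioc 0 R →
      IntervalIntegrable (fun u => u ^ (p / 2 - 1) * G u) volume a b := by
    intro a b ha hb
    have hsub : Set.uIcc a b ⊆ Set.Ioc 0 R := fun t ht =>
      ⟨(lt_min ha.1 hb.1).trans_le ht.1, ht.2.trans (max_le ha.2 hb.2)⟩
    exact (hG.mono hsub).intervalIntegrable.continuousOn_mul
      (continuousOn_id.rpow_const fun t ht => Or.inl (hsub ht).1.ne')
  have hmem : ∀ k, level R θ k ∈ Set.Ioc 0 R := fun k => ⟨level_pos hR k, level_le hR.le hθ k⟩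
  have key : (∑ k ∈ Finset.range n, level R θ k ^ (p / 2) * G (level R θ (k + 1))) * θ
      ≤ Real.exp (θ * p) * ∫ u in level R θ (n + 1)..level R θ 1, u ^ (p / 2 - 1) * G u := by
    clear han
    induction n with
    | zero => simp
    | succ n ih =>
      rw [Finset.sum_range_succ, add_mul, ← intervalIntegral.integral_add_adjacent_intervals
        (hi _ _ (hmem (n + 1 + 1)) (hmem (n + 1))) (hi _ _ (hmem (n + 1)) (hmem 1)), mul_add,
        add_comm]
      refine add_le_add ?_ ih
      have hG1 := hG0 _ (hmem (n + 1))
      have hterm := mul_le_integral_level (C := level R θ (n + 1 + 1) ^ (p / 2)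
        * G (level R θ (n + 1))) hR hθ (n + 1) (hi _ _ (hmem _) (hmem _)) fun t ht => by
          have ht0 : 0 < t := (level_pos hR _).trans_le ht.1
          rw [mul_right_comm, Real.rpow_sub_one ht0.ne', div_eq_mul_inv (t ^ (p / 2))]
          have h1 := hG ⟨ht0, ht.2.trans (hmem _).2⟩ (hmem (n + 1)) ht.2
          have h2 := Real.rpow_le_rpow (hmem (n + 1 + 1)).1.le ht.1 (by linarith : 0 ≤ p / 2)
          gcongr
      have he : level R θ n ^ (p / 2) = Real.exp (θ * p) * level R θ (n + 1 + 1) ^ (p / 2) := by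
        rw [level_eq_exp_mul_succ R θ n, level_eq_exp_mul_succ R θ (n + 1), ← mul_assoc,
          ← Real.exp_add, Real.mul_rpow (Real.exp_pos _).le (hmem _).1.le, ← Real.exp_mul]
        ring_nf
      rw [he]
      calc _ = Real.exp (θ * p) * (level R θ (n + 1 + 1) ^ (p / 2)
            * G (level R θ (n + 1)) * θ) := by ring
        _ ≤ _ := by gcongr
  refine key.trans (mul_le_mul_of_nonneg_left ?_ (Real.exp_pos _).le)
  refine intervalIntegral.integral_mono_interval han (level_antitone hR.le hθ (by omega))
    (hmem 1).2 ?_ (hi _ _ ⟨ha, han.trans (hmem _).2⟩ ⟨hR, le_rfl⟩)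
  filter_upwards [ae_restrict_mem measurableSet_Ioc] with t ht
  have ht0 := ha.trans ht.1
  exact mul_nonneg (Real.rpow_nonneg ht0.le _) (hG0 t ⟨ht0, ht.2⟩)

/-! ### Union bound over layers -/

/-- Union bound over all layers built from given nets. Half of the exponent `2 log N`, where `N`
is the number of layers at step `k`, pays for the number of layers and the other half makes the
sum over `k` geometric. -/
theorem exists_event_layer_deviation_le {Ω S : Type*} [MeasurableSpace Ω] [MeasurableSpace S]
    {μ : Measure Ω} [IsProbabilityMeasure μ] {P : Measure S} [IsProbabilityMeasure P]
    {m : ℕ} {ξ : Fin m → S → Ω} (hξ : ∀ j, Measurable (ξ j)) (hind : iIndepFun ξ P)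
    (hμ : (m : ℝ≥0∞)⁻¹ • ∑ j, P.map (ξ j) = μ) {p ε X : ℝ} {u δ : ℕ → ℝ} {K : ℕ}
    (C : ℕ → Finset (Linf Ω)) (hu : ∀ k, 0 < u k) (hε0 : 0 < ε) (hε1 : ε < 1)
    (hδ0 : ∀ k ≤ K, 0 < δ k) (hδ1 : ∀ k ≤ K, δ k ≤ 1) (hC : ∀ l, 16 / ε ≤ (C l).card)
    (hexp : ∀ k ≤ K, X + 2 * ∑ l ∈ Finset.range (k + 1), Real.log (C l).card
      ≤ m * δ k ^ 2 / (8 * u k ^ p)) :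
    ∃ E : Set S, MeasurableSet E ∧ 1 - ε * Real.exp (-X) ≤ P.real E ∧
      ∀ s ∈ E, ∀ k ≤ K, ∀ g : ℕ → Linf Ω, (∀ l, g l ∈ C l) →
        u k ^ p * μ.real (layer u k fun l => g l) ≤ 2 →
        u k ^ p * |1 / (m : ℝ) * ∑ j, (layer u k fun l => g l).indicator (1 : Ω → ℝ) (ξ j s)
          - μ.real (layer u k fun l => g l)| ≤ δ k := by
  classical
  set T : ∀ k : ℕ, Finset (Fin (k + 1) → Linf Ω) := fun k =>
    (Fintype.piFinset fun l : Fin (k + 1) => C l).filter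
      fun g => u k ^ p * μ.real (layer u k g) ≤ 2 with hT
  set V : ∀ k : ℕ, (Fin (k + 1) → Linf Ω) → Set S := fun k g =>
    {s | δ k / u k ^ p ≤ |1 / (m : ℝ) * ∑ j, (layer u k g).indicator (1 : Ω → ℝ) (ξ j s)
      - μ.real (layer u k g)|} with hV
  have hup : ∀ k, 0 < u k ^ p := fun k => Real.rpow_pos_of_pos (hu k) p
  have hVm : ∀ k g, MeasurableSet (V k g) := by
    intro k g
    have h : ∀ j, Measurable fun s => (layer u k g).indicator (1 : Ω → ℝ) (ξ j s) := fun j =>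
      (measurable_one.indicator (measurableSet_layer u k g)).comp (hξ j)
    exact measurableSet_le measurable_const (by fun_prop)
  have hcard : ∀ l, (0 : ℝ) < (C l).card := fun l => lt_of_lt_of_le (by positivity) (hC l)
  have hVle : ∀ k ≤ K, ∀ g ∈ T k, P.real (V k g)
      ≤ 2 * (Real.exp (-X) * ((∏ l ∈ Finset.range (k + 1), ((C l).card : ℝ)) ^ 2)⁻¹) := by
    intro k hk g hg
    have hg2 := (Finset.mem_filter.mp hg).2
    refine (prob_frequency_deviation_le hξ hind hμ (measurableSet_layer u k g)
      (b := 2 / u k ^ p) (div_pos (hδ0 k hk) (hup k)) ?_ ?_).trans ?_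
    · rw [mul_div_assoc', div_le_div_iff_of_pos_right (hup k)]
      linarith [hδ1 k hk]
    · rw [le_div_iff₀ (hup k), mul_comm]
      exact hg2
    · have e : (m : ℝ) * (δ k / u k ^ p) ^ 2 / (4 * (2 / u k ^ p))
          = m * δ k ^ 2 / (8 * u k ^ p) := by
        field_simp [(hup k).ne']
        ring
      have e2 : Real.exp (-X) * ((∏ l ∈ Finset.range (k + 1), ((C l).card : ℝ)) ^ 2)⁻¹
          = Real.exp (-(X + 2 * ∑ l ∈ Finset.range (k + 1), Real.log (C l).card)) := by
        rw [neg_add, Real.exp_add, Real.exp_neg (2 * _), two_mul, Real.exp_add, Real.exp_sum,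
          Finset.prod_congr rfl fun l _ => Real.exp_log (hcard l), sq]
      rw [e, e2]
      gcongr
      exact hexp k hk
  have hTc : ∀ k, ((T k).card : ℝ) ≤ ∏ l ∈ Finset.range (k + 1), ((C l).card : ℝ) := by
    intro k
    have := Finset.card_filter_le (Fintype.piFinset fun l : Fin (k + 1) => C l)
      fun g => u k ^ p * μ.real (layer u k g) ≤ 2
    rw [Fintype.card_piFinset, Fin.prod_univ_eq_prod_range (fun l => (C l).card)] at this
    exact_mod_cast this
  set B : Set S := ⋃ k ∈ Finset.range (K + 1), ⋃ g ∈ T k, V k g with hB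
  have hBm : MeasurableSet B := Finset.measurableSet_biUnion _ fun k _ =>
    Finset.measurableSet_biUnion _ fun g _ => hVm k g
  have hBle : P.real B ≤ ε * Real.exp (-X) := by
    have hstep : ∀ k ∈ Finset.range (K + 1), P.real (⋃ g ∈ T k, V k g)
        ≤ 2 * Real.exp (-X) * (ε / 16) * (1 / 2) ^ k := by
      intro k hk
      have hkK : k ≤ K := by rw [Finset.mem_range] at hk; omega
      set N := ∏ l ∈ Finset.range (k + 1), ((C l).card : ℝ)
      have hN : (16 / ε) ^ (k + 1) ≤ N := by
        calc _ = ∏ l ∈ Finset.range (k + 1), (16 / ε) := by rw [Finset.prod_const, Finset.card_range]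
          _ ≤ N := Finset.prod_le_prod (fun _ _ => by positivity) fun l _ => hC l
      have hN0 : 0 < N := lt_of_lt_of_le (by positivity) hN
      calc P.real (⋃ g ∈ T k, V k g) ≤ ∑ g ∈ T k, P.real (V k g) :=
            measureReal_biUnion_finset_le _ _
        _ ≤ ∑ _g ∈ T k, 2 * (Real.exp (-X) * (N ^ 2)⁻¹) :=
            Finset.sum_le_sum fun g hg => hVle k hkK g hg
        _ = (T k).card * (2 * (Real.exp (-X) * (N ^ 2)⁻¹)) := by
            rw [Finset.sum_const, nsmul_eq_mul]
        _ ≤ N * (2 * (Real.exp (-X) * (N ^ 2)⁻¹)) := by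
            gcongr
            exact hTc k
        _ = 2 * Real.exp (-X) * N⁻¹ := by field_simp
        _ ≤ 2 * Real.exp (-X) * ((16 / ε) ^ (k + 1))⁻¹ := by gcongr
        _ = 2 * Real.exp (-X) * (ε / 16) * (ε / 16) ^ k := by
            rw [← inv_pow, inv_div, pow_succ]; ring
        _ ≤ _ := by
            gcongr
            linarith
    calc P.real B ≤ ∑ k ∈ Finset.range (K + 1), P.real (⋃ g ∈ T k, V k g) :=
          measureReal_biUnion_finset_le _ _
      _ ≤ ∑ k ∈ Finset.range (K + 1), 2 * Real.exp (-X) * (ε / 16) * (1 / 2) ^ k :=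
          Finset.sum_le_sum hstep
      _ ≤ 2 * Real.exp (-X) * (ε / 16) * 2 := by
          rw [← Finset.mul_sum]
          gcongr
          exact sum_geometric_two_le _
      _ ≤ _ := by nlinarith [mul_pos hε0 (Real.exp_pos (-X))]
  refine ⟨Bᶜ, hBm.compl, ?_, ?_⟩
  · rw [probReal_compl_eq_one_sub hBm]
    linarith
  · intro s hs k hk g hg hle
    by_contra hcon
    refine hs (Set.mem_biUnion (Finset.mem_coe.mpr (Finset.mem_range.mpr (Nat.lt_succ_of_le hk)))
      (Set.mem_biUnion (x := fun l : Fin (k + 1) => g l) ?_ ?_))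
    · exact Finset.mem_coe.mpr (Finset.mem_filter.mpr
        ⟨Fintype.mem_piFinset.mpr fun l => hg l, hle⟩)
    · change δ k / u k ^ p ≤ _
      rw [div_le_iff₀ (hup k), mul_comm]
      exact (not_le.mp hcon).le

/-- The lowest level: small enough to be negligible, but reached after few steps. -/
lemma exists_last_level {p ε R : ℝ} (hp : 1 ≤ p) (hε0 : 0 < ε) (hε1 : ε < 1) (hR : 1 ≤ R) :
    ∃ K : ℕ, (2 * level R (ε / (20 * p)) K) ^ p ≤ ε / 10 ∧
      ε ^ (1 / p) / 64 ≤ level R (ε / (20 * p)) (K + 2) ∧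
      (K + 1 : ℝ) ≤ 104 * p * Real.log (2 * R / ε) / ε := by
  have hp0 : 0 < p := by linarith
  have hR0 : 0 < R := by linarith
  set θ := ε / (20 * p) with hθ
  have hθ0 : 0 < θ := by positivity
  have hθ1 : θ ≤ 1 / 20 := by
    rw [hθ, div_le_div_iff₀ (by positivity) (by norm_num)]; nlinarith
  set z := ε ^ (1 / p) with hz
  have hz0 : 0 < z := Real.rpow_pos_of_pos hε0 _
  have hz1 : z ≤ 1 := Real.rpow_le_one hε0.le hε1.le (by positivity)
  have hzp : z ^ p = ε := by
    rw [hz, ← Real.rpow_mul hε0.le, one_div_mul_cancel hp0.ne', Real.rpow_one]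
  set x := Real.log (20 * R / z) with hx
  have hx0 : 0 ≤ x := by
    apply Real.log_nonneg
    rw [le_div_iff₀ hz0]
    linarith
  have hRx : R * Real.exp (-x) = z / 20 := by
    rw [hx, Real.exp_neg, Real.exp_log (by positivity)]
    field_simp
  set K := ⌈x / θ⌉₊ with hK
  have hK1 : x ≤ θ * K := by
    have := Nat.le_ceil (x / θ)
    rw [div_le_iff₀ hθ0] at this
    linarith
  have hK2 : (K : ℝ) < x / θ + 1 := Nat.ceil_lt_add_one (by positivity)
  refine ⟨K, ?_, ?_, ?_⟩
  · have h1 : 2 * level R θ K ≤ z / 10 := by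
      have : level R θ K ≤ R * Real.exp (-x) := by
        unfold level
        gcongr
      linarith
    calc (2 * level R θ K) ^ p ≤ (z / 10) ^ p :=
          Real.rpow_le_rpow (by linarith [level_pos (θ := θ) hR0 K]) h1 hp0.le
      _ = ε / 10 ^ p := by rw [Real.div_rpow hz0.le (by norm_num), hzp]
      _ ≤ ε / 10 := by
          gcongr
          exact Real.self_le_rpow_of_one_le (by norm_num) hp
  · have h1 : θ * ((K + 2 : ℕ) : ℝ) ≤ x + 3 * θ := by
      have := mul_lt_mul_of_pos_left hK2 hθ0
      rw [mul_add, mul_div_cancel₀ _ hθ0.ne'] at this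
      push_cast
      linarith
    have h2 : z / 20 * Real.exp (-(3 * θ)) ≤ level R θ (K + 2) := by
      rw [← hRx, mul_assoc, ← Real.exp_add]
      unfold level
      gcongr
      linarith
    have h3 := Real.add_one_le_exp (-(3 * θ))
    have h4 : 20 / 64 ≤ Real.exp (-(3 * θ)) := by linarith
    calc z / 64 = z / 20 * (20 / 64) := by ring
      _ ≤ z / 20 * Real.exp (-(3 * θ)) := by gcongr
      _ ≤ _ := h2
  · have hlogε : Real.log ε ≤ 0 := Real.log_nonpos hε0.le hε1.le
    have hlogR : 0 ≤ Real.log R := Real.log_nonneg hR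
    set L := Real.log (2 * R / ε) with hL
    have hLe : L = Real.log 2 + Real.log R - Real.log ε := by
      rw [hL, Real.log_div (by positivity) hε0.ne', Real.log_mul (by norm_num) hR0.ne']
    have hlog2 := Real.log_two_gt_d9
    have hx5 : x ≤ 5 * L := by
      have h20 : Real.log 20 ≤ 5 * Real.log 2 := by
        calc Real.log 20 ≤ Real.log (2 ^ 5) := Real.log_le_log (by norm_num) (by norm_num)
          _ = _ := by rw [Real.log_pow]; norm_num
      have hzl : Real.log ε ≤ Real.log z := by
        rw [hz, Real.log_rpow hε0]
        have : 1 / p ≤ 1 := by rw [div_le_one hp0]; exact hp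
        nlinarith
      rw [hx, Real.log_div (by positivity) hz0.ne', Real.log_mul (by norm_num) hR0.ne']
      linarith
    have hL2 : 1 / 2 ≤ L := by linarith
    rw [le_div_iff₀ hε0]
    have hxθ : x / θ * ε = 20 * p * x := by rw [hθ]; field_simp
    have h2 : 2 * ε ≤ 4 * p * L := by nlinarith
    nlinarith

/-! ### Scaling and the supremum bound -/

lemma norm_apply_le {Ω : Type*} [MeasurableSpace Ω] (f : Linf Ω) (x : Ω) : ‖f x‖ ≤ ‖f‖ :=
  lp.norm_apply_le_norm (by simp) f.1 x

lemma abs_norm_sub_norm_apply_le {Ω : Type*} [MeasurableSpace Ω] (f g : Linf Ω) (x : Ω) :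
    |‖f x‖ - ‖g x‖| ≤ dist f g := by
  rw [dist_eq_norm]
  exact (abs_norm_sub_norm_le _ _).trans (norm_apply_le (f - g) x)

lemma normPow_nonneg {Ω : Type*} [MeasurableSpace Ω] (μ : Measure Ω) (p : ℝ) (f : Linf Ω) :
    0 ≤ normPow μ p f :=
  integral_nonneg fun _ => Real.rpow_nonneg (norm_nonneg _) _

lemma norm_smul_apply {Ω : Type*} [MeasurableSpace Ω] {a : ℝ} (ha : 0 ≤ a) (f : Linf Ω) (x : Ω) :
    ‖(a • f) x‖ = a * ‖f x‖ := by
  have : (a • f) x = a • f x := rfl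
  rw [this, norm_smul, Real.norm_of_nonneg ha]

lemma norm_smul_apply_rpow {Ω : Type*} [MeasurableSpace Ω] {a : ℝ} (ha : 0 ≤ a) (p : ℝ)
    (f : Linf Ω) (x : Ω) : ‖(a • f) x‖ ^ p = a ^ p * ‖f x‖ ^ p := by
  rw [norm_smul_apply ha, Real.mul_rpow ha (norm_nonneg _)]

lemma normPow_smul {Ω : Type*} [MeasurableSpace Ω] (μ : Measure Ω) (p : ℝ) {a : ℝ} (ha : 0 ≤ a)
    (f : Linf Ω) : normPow μ p (a • f) = a ^ p * normPow μ p f := by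
  simp_rw [normPow, norm_smul_apply_rpow ha]
  exact integral_const_mul _ _

lemma mem_unitBallIn {Ω : Type*} [MeasurableSpace Ω] {μ : Measure Ω} {p : ℝ} (hp : 0 < p)
    {W : Set (Linf Ω)} {f : Linf Ω} : f ∈ unitBallIn μ p W ↔ f ∈ W ∧ normPow μ p f ≤ 1 := by
  have h : normPow μ p f ^ (1 / p) ≤ 1 ↔ normPow μ p f ≤ 1 := by
    have := Real.rpow_le_rpow_iff (normPow_nonneg μ p f) zero_le_one
      (one_div_pos.mpr hp)
    rwa [Real.one_rpow] at this
  rw [← h]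
  rfl

lemma norm_apply_le_supBound {Ω : Type*} [MeasurableSpace Ω] {A : Set (Linf Ω)}
    (hA : IsCompact A) {f : Linf Ω} (hf : f ∈ A) (x : Ω) : ‖f x‖ ≤ supBound A := by
  obtain ⟨B, hB⟩ := hA.isBounded.exists_norm_le
  have h1 : ∀ g : Linf Ω, BddAbove (Set.range fun x => ‖g x‖) := fun g =>
    ⟨‖g‖, by rintro _ ⟨y, rfl⟩; exact norm_apply_le g y⟩
  have h2 : BddAbove (Set.range fun g : A => ⨆ x, ‖g.1 x‖) :=
    ⟨B, by
      rintro _ ⟨g, rfl⟩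
      exact Real.iSup_le (fun y => (norm_apply_le g.1 y).trans (hB g.1 g.2))
        ((norm_nonneg _).trans (hB f hf))⟩
  exact (le_ciSup (h1 f) x).trans (le_ciSup h2 ⟨f, hf⟩)

lemma exists_half_supBound_le_norm {Ω : Type*} [MeasurableSpace Ω] {A : Set (Linf Ω)}
    (hA : A.Nonempty) (h : 0 < supBound A) : ∃ f ∈ A, supBound A / 2 ≤ ‖f‖ := by
  have : Nonempty A := hA.to_subtype
  obtain ⟨f, hf⟩ := exists_lt_of_lt_ciSup (show supBound A / 2 < ⨆ f : A, ⨆ x, ‖f.1 x‖ from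
    half_lt_self h)
  exact ⟨f.1, f.2, hf.le.trans (Real.iSup_le (norm_apply_le f.1) (norm_nonneg _))⟩

/-! ### The discretization event -/

/-- The lower bound on `m` makes the sum of the deviations allowed for the entropy small. -/
lemma sum_entropic_deviation_le {p ε R m : ℝ} {K : ℕ} {J : ℝ → ℝ} (hp : 1 ≤ p) (hm0 : 0 < m)
    (hε0 : 0 < ε) (hε1 : ε < 1) (hR0 : 0 < R) (hJanti : AntitoneOn J (Set.Ioc 0 R))
    (hK2 : ε ^ (1 / p) / 64 ≤ level R (ε / (20 * p)) (K + 2))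
    (hm : 204800000 * p ^ 3 / ε ^ 5 *
      (∫ v in (1 / (64 * p) * ε ^ (1 / p))..R, v ^ (p / 2 - 1) * Real.sqrt (J v)) ^ 2 ≤ m) :
    ∑ k ∈ Finset.range (K + 1), 4 / Real.sqrt (m * (ε / (20 * p))) *
      (level R (ε / (20 * p)) k ^ (p / 2) * Real.sqrt (J (level R (ε / (20 * p)) (k + 1))))
      ≤ ε / 20 := by
  have hp0 : 0 < p := by linarith
  set θ := ε / (20 * p) with hθ
  have hθ0 : 0 < θ := by positivity
  have hθp : θ * p = ε / 20 := by rw [hθ]; field_simp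
  set u := level R θ with hu
  have hu0 : ∀ k, 0 < u k := level_pos hR0
  set cp := 1 / (64 * p) with hcp
  have hcp0 : 0 < cp := by positivity
  set I := ∫ v in (cp * ε ^ (1 / p))..R, v ^ (p / 2 - 1) * Real.sqrt (J v) with hI
  have hsum := sum_sqrt_level_le_integral (G := fun v => Real.sqrt (J v)) (p := p) hR0
    (fun a ha b hb hab => Real.sqrt_le_sqrt (hJanti ha hb hab)) (fun t _ => Real.sqrt_nonneg _)
    hθ0.le hp0.le (K + 1) (a := cp * ε ^ (1 / p)) (by positivity) (by
      refine le_trans ?_ hK2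
      have : cp ≤ 1 / 64 := by
        rw [hcp]
        gcongr
        linarith
      have hz : 0 ≤ ε ^ (1 / p) := by positivity
      nlinarith)
  rw [← hI] at hsum
  have hexp2 : Real.exp (θ * p) ≤ 2 := by
    rw [hθp]
    have := (abs_le.mp (Real.abs_exp_sub_one_sub_id_le (x := ε / 20)
      (by rw [abs_of_pos] <;> linarith))).2
    nlinarith
  have hI0 : 0 ≤ I := by
    refine nonneg_of_mul_nonneg_right (le_trans ?_ hsum) (Real.exp_pos _)
    refine mul_nonneg (Finset.sum_nonneg fun k _ => ?_) hθ0.le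
    exact mul_nonneg (Real.rpow_nonneg (hu0 k).le _) (Real.sqrt_nonneg _)
  have hsum2 : (∑ k ∈ Finset.range (K + 1), u k ^ (p / 2) * Real.sqrt (J (u (k + 1)))) * θ
      ≤ 2 * I := hsum.trans (mul_le_mul_of_nonneg_right hexp2 hI0)
  have hsq : 160 * I ≤ θ * ε * Real.sqrt (m * θ) := by
    refine (sq_le_sq₀ (by positivity) (by positivity)).mp ?_
    rw [mul_pow _ (Real.sqrt _), Real.sq_sqrt (by positivity)]
    have h5 : (θ * ε) ^ 2 * (m * θ) = ε ^ 5 / (8000 * p ^ 3) * m := by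
      rw [hθ]; field_simp; ring
    rw [h5]
    calc (160 * I) ^ 2 = ε ^ 5 / (8000 * p ^ 3) * (204800000 * p ^ 3 / ε ^ 5 * I ^ 2) := by
          field_simp; ring
      _ ≤ _ := by gcongr
  have hs0 : 0 < Real.sqrt (m * θ) := Real.sqrt_pos.mpr (by positivity)
  rw [← Finset.mul_sum, div_mul_eq_mul_div, div_le_iff₀ hs0]
  refine le_of_mul_le_mul_right ?_ hθ0
  linarith

/-- The discretization event for the functions of norm one in a compact set `A` of functions
bounded by `R ≥ 1`. The hypothesis on `f₀` makes the entropy of `A` large enough to absorb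
the factor `ε` of the probability estimate. -/
theorem exists_event_discretization {p : ℝ} (hp : 1 ≤ p) {Ω S : Type*} [MeasurableSpace Ω]
    [MeasurableSpace S] {μ : Measure Ω} [IsProbabilityMeasure μ] {P : Measure S}
    [IsProbabilityMeasure P] {m : ℕ} {ξ : Fin m → S → Ω} (hξ : ∀ j, Measurable (ξ j))
    (hind : iIndepFun ξ P) (hμ : (m : ℝ≥0∞)⁻¹ • ∑ j, P.map (ξ j) = μ) {A : Set (Linf Ω)}
    (hA : IsCompact A) {R : ℝ} (hR1 : 1 ≤ R) (hR : ∀ f ∈ A, ∀ x, ‖f x‖ ≤ R) {f₀ : Linf Ω}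
    (hf₀ : R / 2 ≤ ‖f₀‖) (hray : ∀ a : ℝ, 0 < a → a ≤ 1 → a • f₀ ∈ A) {ε : ℝ} (hε0 : 0 < ε)
    (hε1 : ε < 1)
    (hm : 204800000 * p ^ 3 / ε ^ 5 * entropyIntegral p (1 / (64 * p)) ε R A ^ 2 ≤ m) :
    ∃ E : Set S, MeasurableSet E ∧
      1 - ε * Real.exp (-(1 / (34611200 * p ^ 2) * m * ε ^ 4 /
        (R ^ p * Real.log (2 * R / ε) ^ 2))) ≤ P.real E ∧
      ∀ s ∈ E, ∀ f ∈ A, normPow μ p f = 1 →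
        1 - ε ≤ 1 / (m : ℝ) * ∑ j, ‖f (ξ j s)‖ ^ p ∧
        1 / (m : ℝ) * ∑ j, ‖f (ξ j s)‖ ^ p ≤ 1 + ε := by
  have hp0 : 0 < p := by linarith
  have hR0 : 0 < R := by linarith
  have hmpos := one_le_of_average_eq hμ
  have hm0 : (0 : ℝ) < m := by exact_mod_cast hmpos
  obtain ⟨K, hK1, hK2, hK3⟩ := exists_last_level hp hε0 hε1 hR1
  set θ := ε / (20 * p) with hθ
  have hθ0 : 0 < θ := by positivity
  have hθp : θ * p = ε / 20 := by rw [hθ]; field_simp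
  have hθ1 : θ ≤ 1 / 2 := by
    rw [hθ, div_le_div_iff₀ (by positivity) (by norm_num)]; nlinarith
  set u := level R θ with hu
  have hu0 : ∀ k, 0 < u k := level_pos hR0
  have huR : ∀ k, u k ≤ R := level_le hR0.le hθ0.le
  set cp := 1 / (64 * p) with hcp
  have hcp0 : 0 < cp := by positivity
  have hcpε : cp * ε ≤ θ := by
    rw [hcp, hθ, div_mul_eq_mul_div, one_mul]
    gcongr
    norm_num
  set H : ℝ → ℝ := fun t => entropy (cp * ε * t) A with hH
  have hHanti : AntitoneOn H (Set.Ioi 0) := fun s hs t _ hst =>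
    entropy_anti hA ⟨_, hray 1 one_pos le_rfl⟩ (mul_pos (mul_pos hcp0 hε0) hs)
      (mul_le_mul_of_nonneg_left hst (mul_pos hcp0 hε0).le)
  set J : ℝ → ℝ := fun v => ∫ t in v..R, H t / t with hJ
  have hJanti : AntitoneOn J (Set.Ioc 0 R) :=
    antitoneOn_integral_div hHanti (fun t => entropy_nonneg _ A) hR0
  -- the nets and their cardinalities
  have hnet : ∀ l, ∃ C : Finset (Linf Ω),
      (∀ x ∈ A, ∃ y ∈ C, dist x y ≤ cp * ε * u l) ∧
      C.card = (Metric.coveringNumber (cp * ε * u l).toNNReal A).toNat := fun l =>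
    exists_minimal_net hA (mul_pos (mul_pos hcp0 hε0) (hu0 l))
  choose C hCnet hCcard using hnet
  have hC16 : ∀ l, 16 / ε ≤ (C l).card := by
    intro l
    have h1 := hf₀.trans (norm_le_card_mul_of_net hray (hCnet l))
    have h2 : cp * ε * u l ≤ ε / 64 * R := by
      have : cp ≤ 1 / 64 := by
        rw [hcp]
        gcongr
        linarith
      calc cp * ε * u l ≤ 1 / 64 * ε * R := by gcongr; exacts [(hu0 l).le, huR l]
        _ = _ := by ring
    have h3 : R / 2 ≤ (C l).card * (2 * (ε / 64 * R)) := h1.trans (by gcongr)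
    rw [div_le_iff₀ hε0]
    nlinarith
  have hlog : ∀ l, Real.log (C l).card ≤ H (u l) := by
    intro l
    have h0 : 0 ≤ Real.log (C l).card := Real.log_natCast_nonneg _
    simp only [hH, entropy, Real.logb, ← hCcard l]
    rw [le_div_iff₀ (Real.log_pos one_lt_two)]
    nlinarith [Real.log_two_lt_d9]
  have hsumlog : ∀ k, ∑ l ∈ Finset.range (k + 1), Real.log (C l).card ≤ J (u (k + 1)) / θ := by
    intro k
    rw [le_div_iff₀ hθ0]
    exact (mul_le_mul_of_nonneg_right (Finset.sum_le_sum fun l _ => hlog l) hθ0.le).trans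
      (sum_level_le_integral hHanti hR0 hθ0.le (k + 1))
  have hJ0 : ∀ k, 0 ≤ J (u (k + 1)) := by
    intro k
    have h0 : 0 ≤ ∑ l ∈ Finset.range (k + 1), Real.log (C l).card :=
      Finset.sum_nonneg fun l _ => Real.log_natCast_nonneg _
    have := h0.trans (hsumlog k)
    rwa [le_div_iff₀ hθ0, zero_mul] at this
  -- admissible deviations: `d` yields the exponent in the probability, `e k` pays for the entropy
  set d : ℝ := ε / (20 * (K + 1)) with hd
  have hd0 : 0 < d := by positivity
  set e : ℕ → ℝ := fun k => 4 / Real.sqrt (m * θ) * (u k ^ (p / 2) * Real.sqrt (J (u (k + 1))))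
    with he
  have he0 : ∀ k, 0 ≤ e k := fun k => by
    have := Real.rpow_nonneg (hu0 k).le (p / 2)
    positivity
  have hesq : ∀ k, m * e k ^ 2 / (8 * u k ^ p) = 2 * (J (u (k + 1)) / θ) := by
    intro k
    have h1 : (u k ^ (p / 2)) ^ 2 = u k ^ p := by
      rw [← Real.rpow_natCast, ← Real.rpow_mul (hu0 k).le]
      norm_num
    have h2 := (Real.rpow_pos_of_pos (hu0 k) p).ne'
    simp only [he]
    rw [mul_pow, div_pow, mul_pow, h1, Real.sq_sqrt (by positivity), Real.sq_sqrt (hJ0 k)]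
    field_simp
    ring
  have hesum : ∑ k ∈ Finset.range (K + 1), e k ≤ ε / 20 :=
    sum_entropic_deviation_le hp hm0 hε0 hε1 hR0 hJanti hK2 hm
  have hdsum : ∑ k ∈ Finset.range (K + 1), (d + e k) ≤ ε / 10 := by
    rw [Finset.sum_add_distrib, Finset.sum_const, Finset.card_range, nsmul_eq_mul]
    have : ((K + 1 : ℕ) : ℝ) * d = ε / 20 := by
      rw [hd]; push_cast; field_simp
    linarith
  have hle1 : ∀ k ≤ K, d + e k ≤ 1 := by
    intro k hk
    have := Finset.single_le_sum (f := fun k => d + e k) (fun i _ => add_nonneg hd0.le (he0 i))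
      (Finset.mem_range.mpr (Nat.lt_succ_of_le hk))
    linarith
  set L := Real.log (2 * R / ε) with hL
  have hL0 : 0 < L := by
    apply Real.log_pos
    rw [lt_div_iff₀ hε0]
    linarith
  have hdlow : ε ^ 2 / (2080 * p * L) ≤ d := by
    rw [hd, div_le_div_iff₀ (by positivity) (by positivity)]
    rw [le_div_iff₀ hε0] at hK3
    nlinarith
  set X := 1 / (34611200 * p ^ 2) * m * ε ^ 4 / (R ^ p * L ^ 2) with hX
  have hXd : ∀ k, X ≤ m * d ^ 2 / (8 * u k ^ p) := by
    intro k
    have hukp : u k ^ p ≤ R ^ p := Real.rpow_le_rpow (hu0 k).le (huR k) hp0.le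
    have hukp0 := Real.rpow_pos_of_pos (hu0 k) p
    calc X = m * (ε ^ 2 / (2080 * p * L)) ^ 2 / (8 * R ^ p) := by
          rw [hX]; field_simp; norm_num
      _ ≤ _ := by gcongr
  obtain ⟨E, hEm, hEP, hE⟩ := exists_event_layer_deviation_le hξ hind hμ (p := p) (ε := ε) (X := X)
    (u := u) (δ := fun k => d + e k) (K := K) C hu0 hε0 hε1
    (fun k _ => add_pos_of_pos_of_nonneg hd0 (he0 k)) hle1 hC16 (fun k _ => by
      have h2 : m * (d ^ 2 + e k ^ 2) / (8 * u k ^ p) ≤ m * (d + e k) ^ 2 / (8 * u k ^ p) := by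
        have := Real.rpow_pos_of_pos (hu0 k) p
        gcongr
        nlinarith [mul_nonneg hd0.le (he0 k)]
      rw [mul_add, add_div, hesq k] at h2
      linarith [hXd k, hsumlog k])
  refine ⟨E, hEm, hEP, fun s hs f hf hnorm => ?_⟩
  choose g hgC hgd using fun l => hCnet l f hf
  have hg : ∀ k x, |‖f x‖ - ‖g k x‖| ≤ θ * u k := fun k x =>
    (abs_norm_sub_norm_apply_le f (g k) x).trans
      ((hgd k).trans (mul_le_mul_of_nonneg_right hcpε (hu0 k).le))
  have hr : ∀ k, u k ≤ Real.exp θ * u (k + 1) := fun k => (level_eq_exp_mul_succ R θ k).le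
  have hf0 : ∀ x, ‖f x‖ ≤ u 0 := fun x => (hR f hf x).trans_eq (level_zero R θ).symm
  exact discretization_of_layers (u := u) (δ := fun k => d + e k) hmpos hp0.le hθ0.le hθ1 hu0 hr
    hf0 hg hnorm hε0 hε1 (by linarith) hK1 hdsum fun k hk =>
      hE s hs k hk g hgC (layer_measure_le hp0.le hθ0.le hθ1 hu0 hr hf0 hg hnorm
        (by linarith) k)

/-! ### Reduction to functions of norm one -/

theorem theorem7p1 (p : ℝ) (hp : 1 ≤ p) :
    ∃ Cp cp c : ℝ, 0 < Cp ∧ 0 < cp ∧ 0 < c ∧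
      ∀ (Ω : Type*) [MeasurableSpace Ω] (μ : Measure Ω) [IsProbabilityMeasure μ]
        (W : Set (Linf Ω)),
        (∀ a : ℝ, 0 < a → a • W = W) →
        IsCompact (unitBallIn μ p W) →
        ∀ (R : ℝ), R = supBound (unitBallIn μ p W) →
        ∀ (S : Type*) [MeasurableSpace S] (P : Measure S) [IsProbabilityMeasure P]
          (m : ℕ) (ξ : Fin m → S → Ω),
          (∀ j, Measurable (ξ j)) →
          iIndepFun ξ P →
          (m : ℝ≥0∞)⁻¹ • ∑ j, P.map (ξ j) = μ →
          ∀ ε : ℝ, 0 < ε → ε < 1 →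
            Cp / ε ^ 5 * entropyIntegral p cp ε R (unitBallIn μ p W) ^ 2 ≤ (m : ℝ) →
            ∃ E : Set S, MeasurableSet E ∧
              1 - ε * Real.exp (-(c * m * ε ^ 4 / (R ^ p * Real.log (2 * R / ε) ^ 2)))
                ≤ P.real E ∧
              ∀ s ∈ E, ∀ f ∈ unitBallIn μ p W,
                (1 - ε) * normPow μ p f ≤ 1 / (m : ℝ) * ∑ j, ‖f (ξ j s)‖ ^ p ∧
                1 / (m : ℝ) * ∑ j, ‖f (ξ j s)‖ ^ p ≤ (1 + ε) * normPow μ p f := by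
  have hp0 : 0 < p := by linarith
  refine ⟨204800000 * p ^ 3, 1 / (64 * p), 1 / (34611200 * p ^ 2), by positivity, by positivity,
    by positivity, ?_⟩
  intro Ω _ μ _ W hW hcomp R hR S _ P _ m ξ hξ hind hμ ε hε0 hε1 hm
  have hsmul : ∀ a : ℝ, 0 < a → ∀ f ∈ W, a • f ∈ W := fun a ha f hf => by
    rw [← hW a ha]
    exact Set.smul_mem_smul_set hf
  have hsup : ∀ f ∈ unitBallIn μ p W, ∀ x, ‖f x‖ ≤ R := fun f hf x => by
    rw [hR]
    exact norm_apply_le_supBound hcomp hf x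
  -- all multiples of a null function lie in the unit ball, which is bounded
  have hzero : ∀ f ∈ unitBallIn μ p W, normPow μ p f = 0 → ∀ x, ‖f x‖ = 0 := by
    intro f hf hf0 x
    by_contra hne
    have hpos : 0 < ‖f x‖ := lt_of_le_of_ne (norm_nonneg _) (Ne.symm hne)
    have hR0 : 0 ≤ R := (norm_nonneg _).trans (hsup f hf x)
    have ha : 0 < (R + 1) / ‖f x‖ := by positivity
    have hmem : ((R + 1) / ‖f x‖) • f ∈ unitBallIn μ p W := by
      rw [mem_unitBallIn hp0] at hf ⊢
      refine ⟨hsmul _ ha f hf.1, ?_⟩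
      rw [normPow_smul μ p ha.le, hf0, mul_zero]
      exact zero_le_one
    have := hsup _ hmem x
    rw [norm_smul_apply ha.le, div_mul_cancel₀ _ hpos.ne'] at this
    linarith
  have hnormalize : ∀ f ∈ unitBallIn μ p W, 0 < normPow μ p f → ∃ a : ℝ, 0 < a ∧
      a ^ p * normPow μ p f = 1 ∧ a • f ∈ unitBallIn μ p W := by
    intro f hf hpos
    have ha : 0 < normPow μ p f ^ (-(1 / p)) := Real.rpow_pos_of_pos hpos _
    have hap : (normPow μ p f ^ (-(1 / p))) ^ p * normPow μ p f = 1 := by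
      rw [← Real.rpow_mul hpos.le, neg_mul, one_div_mul_cancel hp0.ne', Real.rpow_neg_one,
        inv_mul_cancel₀ hpos.ne']
    refine ⟨_, ha, hap, ?_⟩
    rw [mem_unitBallIn hp0] at hf ⊢
    exact ⟨hsmul _ ha f hf.1, by rw [normPow_smul μ p ha.le, hap]⟩
  have hnull : ∀ f ∈ unitBallIn μ p W, normPow μ p f = 0 → ∀ s,
      (1 - ε) * normPow μ p f ≤ 1 / (m : ℝ) * ∑ j, ‖f (ξ j s)‖ ^ p ∧
      1 / (m : ℝ) * ∑ j, ‖f (ξ j s)‖ ^ p ≤ (1 + ε) * normPow μ p f := by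
    intro f hf hf0 s
    simp [hf0, hzero f hf hf0, Real.zero_rpow hp0.ne']
  by_cases hex : ∃ f ∈ unitBallIn μ p W, 0 < normPow μ p f
  · obtain ⟨f, hf, hpos⟩ := hex
    obtain ⟨a, ha, hap, hmem⟩ := hnormalize f hf hpos
    have hne : (unitBallIn μ p W).Nonempty := ⟨f, hf⟩
    obtain ⟨x₀⟩ := nonempty_of_isProbabilityMeasure μ
    have hR0 : 0 ≤ R := (norm_nonneg _).trans (hsup f hf x₀)
    have hR1 : 1 ≤ R := by
      have h1 : normPow μ p (a • f) ≤ R ^ p := by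
        calc normPow μ p (a • f) ≤ ∫ _x, R ^ p ∂μ :=
              integral_mono (integrable_norm_rpow μ hp0.le _) (integrable_const _) fun x =>
                Real.rpow_le_rpow (norm_nonneg _) (hsup _ hmem x) hp0.le
          _ = R ^ p := by simp
      rw [normPow_smul μ p ha.le, hap] at h1
      by_contra hlt
      exact absurd (Real.rpow_lt_one hR0 (not_le.mp hlt) hp0) (not_lt.mpr h1)
    obtain ⟨f₀, hf₀, hf₀R⟩ := exists_half_supBound_le_norm hne (by rw [← hR]; linarith)
    rw [← hR] at hf₀R
    have hray : ∀ b : ℝ, 0 < b → b ≤ 1 → b • f₀ ∈ unitBallIn μ p W := by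
      intro b hb hb1
      rw [mem_unitBallIn hp0] at hf₀ ⊢
      refine ⟨hsmul b hb f₀ hf₀.1, ?_⟩
      rw [normPow_smul μ p hb.le]
      exact mul_le_one₀ (Real.rpow_le_one hb.le hb1 hp0.le) (normPow_nonneg μ p f₀) hf₀.2
    obtain ⟨E, hEm, hEP, hE⟩ := exists_event_discretization hp hξ hind hμ hcomp hR1 hsup hf₀R hray
      hε0 hε1 hm
    refine ⟨E, hEm, hEP, fun s hs h hh => ?_⟩
    rcases (normPow_nonneg μ p h).eq_or_lt with h0 | hpos'
    · exact hnull h hh h0.symm s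
    · obtain ⟨b, hb, hbp, hbmem⟩ := hnormalize h hh hpos'
      have key := hE s hs _ hbmem (by rw [normPow_smul μ p hb.le, hbp])
      simp_rw [norm_smul_apply_rpow hb.le] at key
      rw [← Finset.mul_sum, mul_left_comm] at key
      have hbp0 : 0 < b ^ p := Real.rpow_pos_of_pos hb p
      constructor
      · refine le_of_mul_le_mul_left ?_ hbp0
        rw [mul_left_comm, hbp, mul_one]
        exact key.1
      · refine le_of_mul_le_mul_left ?_ hbp0
        rw [mul_left_comm _ (1 + ε), hbp, mul_one]
        exact key.2
  · push Not at hex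
    refine ⟨Set.univ, MeasurableSet.univ, ?_, fun s _ f hf =>
      hnull f hf (le_antisymm (hex f hf) (normPow_nonneg μ p f)) s⟩
    rw [probReal_univ]
    have := mul_pos hε0 (Real.exp_pos
      (-(1 / (34611200 * p ^ 2) * m * ε ^ 4 / (R ^ p * Real.log (2 * R / ε) ^ 2))))
    linarith
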